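/- For finite sets $X, Y \subset \mathbb{R}$ and $t \in \mathbb{R}$ write $X+t = t+X = \{x+t : x \in X\}$, $X+Y=\{x+y : x\in X,\ y\in Y\}$ and $XY = \{xy : x \in X,\ y \in Y\}$, and let $$E^*(X,Y) = \#\{(x,x',y,y') \in X\times X\times Y\times Y : xy = x'y'\}$$ denote the multiplicative energy of $X$ and $Y$. There are absolute constants $c, c', C > 0$ such that for every finite set $A \subset \mathbb{R}$ with $|A| \ge 2$ the following hold. 1. There exist $a, a' \in A$ such that $$|(A+a)(A+a')| \ge c\,\frac{|A|^2}{\log |A|}.$$ 2. $$|(A+A)(A+A)| \ge c'\,\frac{|A|^2}{\log |A|}.$$ 3. $$\sum_{a,a' \in A} E^*(a+A,\,a'+A) \le C\,|A|^4 \log |A|.$$ -/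

import Mathlib

open scoped Pointwise

/-! With `p = (-a, -a')`, a solution of `xy = x'y'` in the translates `a + A`, `a' + A` is a pair of
points collinear with `p`. So the energy sum is at most the number of collinear triples in `B ×ˢ B`,
where `B = A ∪ -A`, and it suffices that this number is `O(n ^ 4 log n)`, `n = #B`.

Instead of incidence geometry, the grid is cut by rank into `r × r` cells for every `r ≤ n`. A line
is monotone, so it meets fewer than `2r` cells, and by Cauchy–Schwarz a line with `k` points has
about `k ^ 2 / r` pairs sharing a cell. Weighting by `r` and summing over `r ≤ k / 4` recovers `k ^
3` (`card_pow_three_le_sum_card_filter_cellIndex_eq`). Over all lines each pair of distinct points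
occurs once, and only `O(n ^ 4 / r ^ 2)` pairs share a cell (`card_filter_cellIndex_eq_le`); the
harmonic sum over `r` gives the logarithm.

Averaging over `a, a'` and Cauchy–Schwarz turn the energy bound into the product set bounds. -/

section CollinearTriples

open Finset

/-! ### Cells of the grid, cut by rank. -/

/-- The block containing `x` when `B` is split by rank into `r` blocks of nearly equal size. -/
noncomputable def blockIndex (B : Finset ℝ) (r : ℕ) (x : ℝ) : ℕ := #{b ∈ B | b < x} * r / #B

lemma monotone_card_filter_lt (B : Finset ℝ) : Monotone fun x : ℝ => #{b ∈ B | b < x} := by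
  intro x y hxy
  exact card_le_card fun b hb => by
    simp only [mem_filter] at hb ⊢
    exact ⟨hb.1, hb.2.trans_le hxy⟩

lemma blockIndex_mono (B : Finset ℝ) (r : ℕ) : Monotone (blockIndex B r) := fun _ _ hxy =>
  Nat.div_le_div_right (Nat.mul_le_mul_right r (monotone_card_filter_lt B hxy))

lemma card_filter_lt_strictMonoOn (B : Finset ℝ) :
    StrictMonoOn (fun x : ℝ => #{b ∈ B | b < x}) B := by
  intro x hx y _ hxy
  refine card_lt_card (Finset.ssubset_iff_of_subset ?_ |>.2 ⟨x, ?_, ?_⟩)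
  · intro b hb
    simp only [mem_filter] at hb ⊢
    exact ⟨hb.1, hb.2.trans hxy⟩
  · simpa using ⟨hx, hxy⟩
  · simp

lemma blockIndex_lt {B : Finset ℝ} {r : ℕ} (hr : 0 < r) {x : ℝ} (hx : x ∈ B) :
    blockIndex B r x < r := by
  have h : #{b ∈ B | b < x} < #B :=
    card_lt_card (filter_ssubset.2 ⟨x, hx, lt_irrefl x⟩)
  rw [blockIndex, Nat.div_lt_iff_lt_mul (by omega), mul_comm r]
  exact Nat.mul_lt_mul_of_pos_right h hr

lemma card_filter_blockIndex_eq_le (B : Finset ℝ) {r : ℕ} (hr : 0 < r) (x : ℝ) :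
    #{y ∈ B | blockIndex B r x = blockIndex B r y} ≤ 2 * (#B / r) + 1 := by
  rcases B.eq_empty_or_nonempty with rfl | hB
  · simp
  have hB' : 0 < #B := hB.card_pos
  set k := #{b ∈ B | b < x} with hk
  have : #{y ∈ B | blockIndex B r x = blockIndex B r y} ≤
      #(Icc (k - #B / r) (k + #B / r)) := by
    refine card_le_card_of_injOn (fun y => #{b ∈ B | b < y}) ?_ ?_
    · intro y hy
      simp only [coe_filter, Set.mem_ofPred_eq, blockIndex, ← hk] at hy
      obtain ⟨-, hy⟩ := hy
      simp only [coe_Icc, Set.mem_Icc]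
      set l := #{b ∈ B | b < y}
      have h1 := Nat.div_add_mod (k * r) #B
      have h2 := Nat.div_add_mod (l * r) #B
      have h3 := Nat.mod_lt (k * r) hB'
      have h4 := Nat.mod_lt (l * r) hB'
      rw [hy] at h1
      have h5 : (k - l) * r ≤ #B := by rw [Nat.sub_mul]; omega
      have h6 : (l - k) * r ≤ #B := by rw [Nat.sub_mul]; omega
      have h7 := (Nat.le_div_iff_mul_le hr).2 h5
      have h8 := (Nat.le_div_iff_mul_le hr).2 h6
      omega
    · exact (card_filter_lt_strictMonoOn B).injOn.mono fun y hy => (mem_filter.1 hy).1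
  rw [Nat.card_Icc] at this
  omega

/-- The pair of block indices of the two coordinates. -/
noncomputable def cellIndex (B : Finset ℝ) (r : ℕ) (p : ℝ × ℝ) : ℕ × ℕ :=
  (blockIndex B r p.1, blockIndex B r p.2)

lemma card_filter_cellIndex_eq_le (B : Finset ℝ) {r : ℕ} (hr : 0 < r) (hrB : r ≤ #B) :
    (#{x ∈ (B ×ˢ B) ×ˢ (B ×ˢ B) | cellIndex B r x.1 = cellIndex B r x.2} : ℝ) ≤
      9 * (#B : ℝ) ^ 4 / r ^ 2 := by
  have hr' : (0 : ℝ) < r := by exact_mod_cast hr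
  have hblock (x : ℝ) : (#{y ∈ B | blockIndex B r x = blockIndex B r y} : ℝ) ≤ 3 * #B / r := by
    have h1 : (#{y ∈ B | blockIndex B r x = blockIndex B r y} : ℝ) ≤ 2 * (#B / r : ℕ) + 1 := by
      exact_mod_cast card_filter_blockIndex_eq_le B hr x
    have h2 : ((#B / r : ℕ) : ℝ) ≤ #B / r := Nat.cast_div_le
    have h3 : (1 : ℝ) ≤ #B / r := by
      rw [one_le_div hr']; exact_mod_cast hrB
    calc _ ≤ _ := h1
      _ ≤ 3 * (#B / r : ℝ) := by linarith
      _ = _ := by ring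
  have hcell (p : ℝ × ℝ) : (#{q ∈ B ×ˢ B | cellIndex B r p = cellIndex B r q} : ℝ) ≤
      (3 * #B / r) ^ 2 := by
    have : {q ∈ B ×ˢ B | cellIndex B r p = cellIndex B r q} =
        {y ∈ B | blockIndex B r p.1 = blockIndex B r y} ×ˢ
          {y ∈ B | blockIndex B r p.2 = blockIndex B r y} := by
      ext q
      simp only [cellIndex, mem_filter, mem_product, Prod.mk.injEq]
      tauto
    rw [this, card_product, Nat.cast_mul, sq]
    exact mul_le_mul (hblock _) (hblock _) (by positivity) (by positivity)
  rw [card_filter, sum_product]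
  simp only [← card_filter]
  push_cast
  calc _ ≤ ∑ _p ∈ B ×ˢ B, (3 * #B / r : ℝ) ^ 2 := sum_le_sum fun p _ => hcell p
    _ = _ := by
      rw [sum_const, card_product, nsmul_eq_mul]
      push_cast
      ring

/-- If a function with at most `m` values determines `g`, then many pairs agree under `g`. -/
lemma card_sq_le_mul_card_filter_eq {α β : Type*} [DecidableEq β] (S : Finset α)
    (g : α → β) (ψ : α → ℕ) (m : ℕ) (hψ : ∀ p ∈ S, ψ p < m)
    (h : ∀ p ∈ S, ∀ q ∈ S, ψ p = ψ q → g p = g q) :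
    #S ^ 2 ≤ m * #{x ∈ S ×ˢ S | g x.1 = g x.2} := by
  have hmaps : Set.MapsTo ψ S (range m) := fun p hp => by simpa using hψ p hp
  have h1 : #{x ∈ S ×ˢ S | ψ x.1 = ψ x.2} = ∑ c ∈ range m, #{p ∈ S | ψ p = c} ^ 2 := by
    have hmaps' : Set.MapsTo (fun x : α × α => ψ x.1)
        ({x ∈ S ×ˢ S | ψ x.1 = ψ x.2} : Finset (α × α)) (range m) := fun x hx => by
      simp only [coe_filter, mem_product, Set.mem_ofPred_eq] at hx
      exact hmaps hx.1.1
    rw [card_eq_sum_card_fiberwise hmaps']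
    refine sum_congr rfl fun c _ => ?_
    rw [sq, ← card_product]
    congr 1
    ext x
    simp only [mem_filter, mem_product]
    constructor
    · rintro ⟨⟨⟨h1, h2⟩, h3⟩, h4⟩
      exact ⟨⟨h1, h4⟩, h2, h3 ▸ h4⟩
    · rintro ⟨⟨h1, h4⟩, h2, h3⟩
      exact ⟨⟨⟨h1, h2⟩, h4.trans h3.symm⟩, h4⟩
  calc #S ^ 2 = (∑ c ∈ range m, #{p ∈ S | ψ p = c}) ^ 2 := by
        rw [card_eq_sum_card_fiberwise hmaps]
    _ ≤ #(range m) * ∑ c ∈ range m, #{p ∈ S | ψ p = c} ^ 2 := sq_sum_le_card_mul_sum_sq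
    _ = m * #{x ∈ S ×ˢ S | ψ x.1 = ψ x.2} := by rw [card_range, h1]
    _ ≤ _ := by
        refine Nat.mul_le_mul_left m (card_le_card fun x hx => ?_)
        simp only [mem_filter, mem_product] at hx ⊢
        exact ⟨hx.1, h _ hx.1.1 _ hx.1.2 hx.2⟩

/-- A set on which the coordinates are comonotone or antimonotone meets fewer than `2 * r` cells. -/
lemma card_sq_le_card_filter_cellIndex_eq (B : Finset ℝ) {r : ℕ} (hr : 0 < r)
    (S : Finset (ℝ × ℝ)) (hS : S ⊆ B ×ˢ B)
    (hmono : (∀ p ∈ S, ∀ q ∈ S, 0 ≤ (p.1 - q.1) * (p.2 - q.2)) ∨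
      ∀ p ∈ S, ∀ q ∈ S, (p.1 - q.1) * (p.2 - q.2) ≤ 0) :
    #S ^ 2 ≤ 2 * r * #{x ∈ S ×ˢ S | cellIndex B r x.1 = cellIndex B r x.2} := by
  have hlt (p) (hp : p ∈ S) : blockIndex B r p.1 < r ∧ blockIndex B r p.2 < r := by
    have := mem_product.1 (hS hp)
    exact ⟨blockIndex_lt hr this.1, blockIndex_lt hr this.2⟩
  have hm := blockIndex_mono B r
  rcases hmono with hmono | hmono
  -- Both indices move in the same direction along `S`, so their sum determines each of them; it
  -- takes fewer than `2 * r` values.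
  · refine card_sq_le_mul_card_filter_eq S _
      (fun p => blockIndex B r p.1 + blockIndex B r p.2) _ ?_ ?_
    · intro p hp
      have := hlt p hp
      omega
    · intro p hp q hq hpq
      have h := hmono p hp q hq
      simp only [cellIndex, Prod.mk.injEq] at hpq ⊢
      rcases lt_trichotomy p.1 q.1 with h1 | h1 | h1
      · have := hm (show p.2 ≤ q.2 by nlinarith)
        have := hm h1.le
        omega
      · rw [h1] at hpq ⊢
        omega
      · have := hm (show q.2 ≤ p.2 by nlinarith)
        have := hm h1.le
        omega
  -- Reversing the order of the second blocks reduces to the same argument.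
  · refine card_sq_le_mul_card_filter_eq S _
      (fun p => blockIndex B r p.1 + (r - 1 - blockIndex B r p.2)) _ ?_ ?_
    · intro p hp
      have := hlt p hp
      omega
    · intro p hp q hq hpq
      have h := hmono p hp q hq
      have := hlt p hp
      have := hlt q hq
      simp only [cellIndex, Prod.mk.injEq] at hpq ⊢
      rcases lt_trichotomy p.1 q.1 with h1 | h1 | h1
      · have := hm (show q.2 ≤ p.2 by nlinarith)
        have := hm h1.le
        omega
      · rw [h1] at hpq ⊢
        omega
      · have := hm (show p.2 ≤ q.2 by nlinarith)
        have := hm h1.le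
        omega

/-! ### Lines in the grid. -/

/-- The points of `P` on the line through `p` and `q`. -/
noncomputable def pointsOnLine (P : Finset (ℝ × ℝ)) (p q : ℝ × ℝ) : Finset (ℝ × ℝ) :=
  {s ∈ P | (q.1 - p.1) * (s.2 - p.2) = (q.2 - p.2) * (s.1 - p.1)}

lemma direction_mul_eq_of_mem_pointsOnLine {P : Finset (ℝ × ℝ)} {p q s t : ℝ × ℝ}
    (hs : s ∈ pointsOnLine P p q) (ht : t ∈ pointsOnLine P p q) :
    (q.1 - p.1) * (s.2 - t.2) = (q.2 - p.2) * (s.1 - t.1) := by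
  have h1 := (mem_filter.1 hs).2
  have h2 := (mem_filter.1 ht).2
  linear_combination h1 - h2

lemma pointsOnLine_eq_of_mem {P : Finset (ℝ × ℝ)} {p q s t : ℝ × ℝ} (hpq : p ≠ q) (hst : s ≠ t)
    (hs : s ∈ pointsOnLine P p q) (ht : t ∈ pointsOnLine P p q) :
    pointsOnLine P s t = pointsOnLine P p q := by
  have h := direction_mul_eq_of_mem_pointsOnLine hs ht
  have h1 := (mem_filter.1 hs).2
  have hd : q.1 - p.1 ≠ 0 ∨ q.2 - p.2 ≠ 0 := by
    by_contra! hc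
    exact hpq (Prod.ext (by linarith [hc.1]) (by linarith [hc.2]))
  have he : t.1 - s.1 ≠ 0 ∨ t.2 - s.2 ≠ 0 := by
    by_contra! hc
    exact hst (Prod.ext (by linarith [hc.1]) (by linarith [hc.2]))
  ext u
  simp only [pointsOnLine, mem_filter, and_congr_right_iff]
  intro _
  constructor
  · intro hu
    rcases he with he | he
    · apply mul_left_cancel₀ he
      linear_combination (q.1 - p.1) * hu + (t.1 - s.1) * h1 - (u.1 - s.1) * h
    · apply mul_left_cancel₀ he
      linear_combination (q.2 - p.2) * hu + (t.2 - s.2) * h1 - (u.2 - s.2) * h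
  · intro hu
    have hu' : (q.1 - p.1) * (u.2 - s.2) = (q.2 - p.2) * (u.1 - s.1) := by
      linear_combination hu - h1
    rcases hd with hd | hd
    · apply mul_left_cancel₀ hd
      linear_combination (t.1 - s.1) * hu' + (u.1 - s.1) * h
    · apply mul_left_cancel₀ hd
      linear_combination (t.2 - s.2) * hu' + (u.2 - s.2) * h

lemma pointsOnLine_monotone_or_antitone (P : Finset (ℝ × ℝ)) {p q : ℝ × ℝ} (hpq : p ≠ q) :
    (∀ s ∈ pointsOnLine P p q, ∀ t ∈ pointsOnLine P p q, 0 ≤ (s.1 - t.1) * (s.2 - t.2)) ∨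
      ∀ s ∈ pointsOnLine P p q, ∀ t ∈ pointsOnLine P p q, (s.1 - t.1) * (s.2 - t.2) ≤ 0 := by
  have hd : 0 < (q.1 - p.1) ^ 2 + (q.2 - p.2) ^ 2 := by
    by_contra! hc
    exact hpq (Prod.ext (by nlinarith [sq_nonneg (q.1 - p.1), sq_nonneg (q.2 - p.2)])
      (by nlinarith [sq_nonneg (q.1 - p.1), sq_nonneg (q.2 - p.2)]))
  -- Differences along the line are parallel to `q - p`, so the product of their coordinates has the
  -- sign of that of `q - p`.
  have key (s) (hs : s ∈ pointsOnLine P p q) (t) (ht : t ∈ pointsOnLine P p q) :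
      ((q.1 - p.1) ^ 2 + (q.2 - p.2) ^ 2) * ((s.1 - t.1) * (s.2 - t.2)) =
        ((q.1 - p.1) * (q.2 - p.2)) * ((s.1 - t.1) ^ 2 + (s.2 - t.2) ^ 2) := by
    have h := direction_mul_eq_of_mem_pointsOnLine hs ht
    linear_combination ((q.1 - p.1) * (s.1 - t.1) - (q.2 - p.2) * (s.2 - t.2)) * h
  rcases le_total 0 ((q.1 - p.1) * (q.2 - p.2)) with h0 | h0
  · left
    intro s hs t ht
    refine nonneg_of_mul_nonneg_right ?_ hd
    rw [key s hs t ht]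
    positivity
  · right
    intro s hs t ht
    refine nonpos_of_mul_nonpos_right ?_ hd
    rw [key s hs t ht]
    exact mul_nonpos_of_nonpos_of_nonneg h0 (by positivity)

lemma card_pointsOnLine_le (B : Finset ℝ) {p q : ℝ × ℝ} (hpq : p ≠ q) :
    #(pointsOnLine (B ×ˢ B) p q) ≤ #B := by
  have hd : q.1 - p.1 ≠ 0 ∨ q.2 - p.2 ≠ 0 := by
    by_contra! hc
    exact hpq (Prod.ext (by linarith [hc.1]) (by linarith [hc.2]))
  have hmem (s) (hs : s ∈ pointsOnLine (B ×ˢ B) p q) : s.1 ∈ B ∧ s.2 ∈ B :=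
    mem_product.1 (mem_filter.1 hs).1
  rcases hd with hd | hd
  · refine card_le_card_of_injOn Prod.fst (fun s hs => (hmem s hs).1) fun s hs t ht hst => ?_
    have h := direction_mul_eq_of_mem_pointsOnLine hs ht
    rw [hst, sub_self, mul_zero] at h
    exact Prod.ext hst (sub_eq_zero.1 ((mul_eq_zero.1 h).resolve_left hd))
  · refine card_le_card_of_injOn Prod.snd (fun s hs => (hmem s hs).2) fun s hs t ht hst => ?_
    have h := direction_mul_eq_of_mem_pointsOnLine hs ht
    rw [hst, sub_self, mul_zero] at h
    exact Prod.ext (sub_eq_zero.1 ((mul_eq_zero.1 h.symm).resolve_left hd)) hst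

/-! ### Counting collinear triples. -/

/-- For `r ≤ #S / 4` the diagonal costs at most half of the Cauchy–Schwarz bound, leaving `#S ^ 2 /
4`. There are at least `#S / 8` such `r`, whence 32. -/
lemma card_pow_three_le_sum_card_filter_cellIndex_eq (B : Finset ℝ) (S : Finset (ℝ × ℝ))
    (hS : S ⊆ B ×ˢ B) (hcard : #S ≤ #B)
    (hmono : (∀ p ∈ S, ∀ q ∈ S, 0 ≤ (p.1 - q.1) * (p.2 - q.2)) ∨
      ∀ p ∈ S, ∀ q ∈ S, (p.1 - q.1) * (p.2 - q.2) ≤ 0) (h2 : 2 ≤ #S) :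
    (#S : ℝ) ^ 3 ≤ 32 * ∑ r ∈ Icc 1 #B,
      (r : ℝ) * #{x ∈ S.offDiag | cellIndex B r x.1 = cellIndex B r x.2} := by
  have hr (r : ℕ) (hr : 0 < r) : (#S : ℝ) ^ 2 / 2 - r * #S ≤
      r * #{x ∈ S.offDiag | cellIndex B r x.1 = cellIndex B r x.2} := by
    have h1 := card_sq_le_card_filter_cellIndex_eq B hr S hS hmono
    have h3 : #{x ∈ S ×ˢ S | cellIndex B r x.1 = cellIndex B r x.2} ≤
        #S + #{x ∈ S.offDiag | cellIndex B r x.1 = cellIndex B r x.2} := by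
      rw [← diag_union_offDiag, filter_union]
      refine (card_union_le _ _).trans (Nat.add_le_add_right ?_ _)
      exact (card_filter_le _ _).trans_eq (diag_card S)
    have h4 : #S ^ 2 ≤
        2 * r * (#S + #{x ∈ S.offDiag | cellIndex B r x.1 = cellIndex B r x.2}) :=
      h1.trans (Nat.mul_le_mul_left _ h3)
    have h5 : (#S : ℝ) ^ 2 ≤
        2 * r * (#S + #{x ∈ S.offDiag | cellIndex B r x.1 = cellIndex B r x.2}) := by
      exact_mod_cast h4
    linarith
  have h2' : (2 : ℝ) ≤ #S := by exact_mod_cast h2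
  rcases le_or_gt 4 #S with h4 | h4
  · have hsub : Icc 1 (#S / 4) ⊆ Icc 1 #B := Icc_subset_Icc le_rfl (by omega)
    have hterm : ∀ r ∈ Icc 1 (#S / 4), (#S : ℝ) ^ 2 / 4 ≤
        r * #{x ∈ S.offDiag | cellIndex B r x.1 = cellIndex B r x.2} := by
      intro r hr'
      rw [mem_Icc] at hr'
      have h6 : (4 * r : ℝ) ≤ #S := by
        have : 4 * r ≤ #S := by omega
        exact_mod_cast this
      nlinarith [hr r (by omega)]
    have h7 : (#S : ℝ) ≤ 8 * (#S / 4 : ℕ) := by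
      have : #S ≤ 8 * (#S / 4) := by omega
      exact_mod_cast this
    have h8 : (#S / 4 : ℕ) * ((#S : ℝ) ^ 2 / 4) ≤ ∑ r ∈ Icc 1 #B,
        (r : ℝ) * #{x ∈ S.offDiag | cellIndex B r x.1 = cellIndex B r x.2} := by
      calc (#S / 4 : ℕ) * ((#S : ℝ) ^ 2 / 4) = ∑ _r ∈ Icc 1 (#S / 4), (#S : ℝ) ^ 2 / 4 := by simp
        _ ≤ _ := sum_le_sum hterm
        _ ≤ _ := sum_le_sum_of_subset_of_nonneg hsub fun _ _ _ => by positivity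
    have h9 : (#S : ℝ) ^ 3 ≤ 32 * ((#S / 4 : ℕ) * ((#S : ℝ) ^ 2 / 4)) := by
      have := mul_le_mul_of_nonneg_right h7 (sq_nonneg (#S : ℝ))
      linarith
    linarith
  -- No `r` satisfies `4 * r ≤ #S` here, but `r = 1`, with its single cell, suffices.
  · have h4' : (#S : ℝ) ≤ 4 := by exact_mod_cast h4.le
    have h1 : (1 : ℕ) ∈ Icc 1 #B := by rw [mem_Icc]; omega
    have h5 := single_le_sum (f := fun r : ℕ =>
      (r : ℝ) * #{x ∈ S.offDiag | cellIndex B r x.1 = cellIndex B r x.2})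
      (fun _ _ => by positivity) h1
    have h6 : {x ∈ S.offDiag | cellIndex B 1 x.1 = cellIndex B 1 x.2} = S.offDiag := by
      refine filter_true_of_mem fun x hx => ?_
      rw [mem_offDiag] at hx
      have ha := mem_product.1 (hS hx.1)
      have hb := mem_product.1 (hS hx.2.1)
      have := blockIndex_lt one_pos ha.1
      have := blockIndex_lt one_pos ha.2
      have := blockIndex_lt one_pos hb.1
      have := blockIndex_lt one_pos hb.2
      simp only [cellIndex, Prod.mk.injEq]
      omega
    have h7 : (#S.offDiag : ℝ) = #S * #S - #S := by
      rw [offDiag_card, Nat.cast_sub (Nat.le_mul_self _), Nat.cast_mul]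
    simp only [h6, h7, Nat.cast_one, one_mul] at h5
    have h8 : (#S : ℝ) ^ 3 ≤ 32 * (#S * #S - #S) := by
      nlinarith [mul_nonneg (sub_nonneg.2 h2') (sub_nonneg.2 h4')]
    linarith

lemma offDiag_filter_pointsOnLine_eq {P : Finset (ℝ × ℝ)} {p q : ℝ × ℝ}
    (hpq : p ≠ q) :
    {x ∈ P.offDiag | pointsOnLine P x.1 x.2 = pointsOnLine P p q} =
      (pointsOnLine P p q).offDiag := by
  ext x
  simp only [mem_filter, mem_offDiag]
  constructor
  · rintro ⟨⟨h1, h2, h3⟩, h4⟩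
    rw [← h4]
    refine ⟨?_, ?_, h3⟩ <;> simp only [pointsOnLine, mem_filter]
    · exact ⟨h1, by ring⟩
    · exact ⟨h2, by ring⟩
  · rintro ⟨h1, h2, h3⟩
    exact ⟨⟨(mem_filter.1 h1).1, (mem_filter.1 h2).1, h3⟩, pointsOnLine_eq_of_mem hpq h3 h1 h2⟩

lemma sum_offDiag_card_pointsOnLine_le (B : Finset ℝ) :
    ∑ x ∈ (B ×ˢ B).offDiag, (#(pointsOnLine (B ×ˢ B) x.1 x.2) : ℝ) ≤
      288 * (#B : ℝ) ^ 4 * (1 + Real.log #B) := by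
  set P := B ×ˢ B with hP
  set lines := P.offDiag.image fun x => pointsOnLine P x.1 x.2 with hlines
  have hmaps : ∀ x ∈ P.offDiag, pointsOnLine P x.1 x.2 ∈ lines :=
    fun x hx => mem_image_of_mem _ hx
  have hfiber : ∀ S ∈ lines, {x ∈ P.offDiag | pointsOnLine P x.1 x.2 = S} = S.offDiag := by
    intro S hS
    obtain ⟨x, hx, rfl⟩ := mem_image.1 hS
    rw [mem_offDiag] at hx
    exact offDiag_filter_pointsOnLine_eq hx.2.2
  have hline : ∀ S ∈ lines, (#S : ℝ) ^ 3 ≤ 32 * ∑ r ∈ Icc 1 #B,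
      (r : ℝ) * #{x ∈ S.offDiag | cellIndex B r x.1 = cellIndex B r x.2} := by
    intro S hS
    obtain ⟨x, hx, rfl⟩ := mem_image.1 hS
    have hx' := mem_offDiag.1 hx
    refine card_pow_three_le_sum_card_filter_cellIndex_eq B _ (filter_subset _ _)
      (card_pointsOnLine_le B hx'.2.2) (pointsOnLine_monotone_or_antitone P hx'.2.2) ?_
    refine one_lt_card.2 ⟨x.1, ?_, x.2, ?_, hx'.2.2⟩ <;> simp only [pointsOnLine, mem_filter]
    · exact ⟨hx'.1, by ring⟩
    · exact ⟨hx'.2.1, by ring⟩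
  have hcells (r : ℕ) :
      ∑ S ∈ lines, (#{x ∈ S.offDiag | cellIndex B r x.1 = cellIndex B r x.2} : ℝ) =
        #{x ∈ P.offDiag | cellIndex B r x.1 = cellIndex B r x.2} := by
    rw [card_eq_sum_card_fiberwise (f := fun x => pointsOnLine P x.1 x.2) (t := lines)
      (fun x hx => hmaps x (mem_filter.1 hx).1)]
    push_cast
    refine sum_congr rfl fun S hS => ?_
    rw [← hfiber S hS, filter_filter, filter_filter]
    simp only [and_comm]
  have hpairs : ∀ r ∈ Icc 1 #B,
      (r : ℝ) * #{x ∈ P.offDiag | cellIndex B r x.1 = cellIndex B r x.2} ≤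
        9 * (#B : ℝ) ^ 4 * (r : ℝ)⁻¹ := by
    intro r hr
    rw [mem_Icc] at hr
    have hr' : (0 : ℝ) < r := by exact_mod_cast hr.1
    have h1 : (#{x ∈ P.offDiag | cellIndex B r x.1 = cellIndex B r x.2} : ℝ) ≤
        #{x ∈ P ×ˢ P | cellIndex B r x.1 = cellIndex B r x.2} := by
      exact_mod_cast card_le_card (filter_subset_filter _
        (subset_union_right.trans_eq (diag_union_offDiag P)))
    calc _ ≤ (r : ℝ) * (9 * (#B : ℝ) ^ 4 / r ^ 2) :=
          mul_le_mul_of_nonneg_left (h1.trans (card_filter_cellIndex_eq_le B hr.1 hr.2)) hr'.le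
      _ = _ := by field_simp
  have hharm : ∑ r ∈ Icc 1 #B, (r : ℝ)⁻¹ ≤ 1 + Real.log #B := by
    have := harmonic_le_one_add_log #B
    simpa only [harmonic_eq_sum_Icc, Rat.cast_sum, Rat.cast_inv, Rat.cast_natCast] using this
  calc ∑ x ∈ P.offDiag, (#(pointsOnLine P x.1 x.2) : ℝ)
      = ∑ S ∈ lines, ∑ x ∈ P.offDiag with pointsOnLine P x.1 x.2 = S,
          (#(pointsOnLine P x.1 x.2) : ℝ) := (sum_fiberwise_of_maps_to hmaps _).symm
    _ ≤ ∑ S ∈ lines, (#S : ℝ) ^ 3 := by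
        refine sum_le_sum fun S hS => ?_
        rw [sum_congr rfl (g := fun _ => (#S : ℝ)) fun x hx => by rw [(mem_filter.1 hx).2],
          sum_const, hfiber S hS, nsmul_eq_mul, pow_succ]
        have : #S.offDiag ≤ #S ^ 2 := by rw [offDiag_card, sq]; exact Nat.sub_le _ _
        exact mul_le_mul_of_nonneg_right (by exact_mod_cast this) (by positivity)
    _ ≤ ∑ S ∈ lines, 32 * ∑ r ∈ Icc 1 #B,
          (r : ℝ) * #{x ∈ S.offDiag | cellIndex B r x.1 = cellIndex B r x.2} := sum_le_sum hline
    _ = 32 * ∑ r ∈ Icc 1 #B,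
          (r : ℝ) * #{x ∈ P.offDiag | cellIndex B r x.1 = cellIndex B r x.2} := by
        rw [← mul_sum, sum_comm]
        simp only [← mul_sum, hcells]
    _ ≤ 32 * ∑ r ∈ Icc 1 #B, 9 * (#B : ℝ) ^ 4 * (r : ℝ)⁻¹ := 
        mul_le_mul_of_nonneg_left (sum_le_sum hpairs) (by norm_num)
    _ = 288 * (#B : ℝ) ^ 4 * ∑ r ∈ Icc 1 #B, (r : ℝ)⁻¹ := by rw [← mul_sum]; ring
    _ ≤ _ := by gcongr

/-- The number of collinear triples, degenerate ones included, in a Cartesian square. -/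
lemma sum_card_pointsOnLine_le {B : Finset ℝ} (hB : B.Nonempty) :
    ∑ p ∈ B ×ˢ B, ∑ q ∈ B ×ˢ B, (#(pointsOnLine (B ×ˢ B) p q) : ℝ) ≤
      289 * (#B : ℝ) ^ 4 * (1 + Real.log #B) := by
  have hlog : 0 ≤ Real.log #B := Real.log_nonneg (by exact_mod_cast hB.card_pos)
  -- For `p = q` the collinearity condition is vacuous; these terms raise 288 to 289.
  have hdiag : ∑ x ∈ (B ×ˢ B).diag, (#(pointsOnLine (B ×ˢ B) x.1 x.2) : ℝ) ≤ (#B : ℝ) ^ 4 := by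
    calc _ ≤ ∑ _x ∈ (B ×ˢ B).diag, (#B : ℝ) ^ 2 := by
          refine sum_le_sum fun x _ => ?_
          have h : #(pointsOnLine (B ×ˢ B) x.1 x.2) ≤ #(B ×ˢ B) := card_filter_le _ _
          rw [card_product, ← sq] at h
          exact_mod_cast h
      _ = _ := by
          rw [sum_const, diag_card, card_product, nsmul_eq_mul]
          push_cast
          ring
  rw [← sum_product' (B ×ˢ B) (B ×ˢ B) fun p q => (#(pointsOnLine (B ×ˢ B) p q) : ℝ),
    ← diag_union_offDiag, sum_union (disjoint_diag_offDiag _)]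
  have h : 0 ≤ (#B : ℝ) ^ 4 * Real.log #B := by positivity
  linarith [sum_offDiag_card_pointsOnLine_le B]

/-! ### From collinear triples to energy and product sets. -/

lemma mulEnergy_translate_le {A B : Finset ℝ} (hA : A ⊆ B) (a a' : ℝ) :
    mulEnergy ({a} + A) ({a'} + A) ≤
      ∑ q ∈ B ×ˢ B, #(pointsOnLine (B ×ˢ B) (-a, -a') q) := by
  have hmem {a x : ℝ} (hx : x ∈ {a} + A) : x - a ∈ B := by
    simp only [mem_add, mem_singleton, exists_eq_left] at hx
    obtain ⟨b, hb, rfl⟩ := hx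
    simpa using hA hb
  have hcount : ∑ q ∈ B ×ˢ B, #(pointsOnLine (B ×ˢ B) (-a, -a') q) =
      #{x ∈ (B ×ˢ B) ×ˢ (B ×ˢ B) | x.2 ∈ pointsOnLine (B ×ˢ B) (-a, -a') x.1} := by
    rw [card_filter, sum_product (B ×ˢ B) (B ×ˢ B)]
    refine sum_congr rfl fun q _ => ?_
    rw [← card_filter]
    congr 1
    ext s
    simp [pointsOnLine]
  rw [hcount, mulEnergy]
  -- Seen from `(-a, -a')`, the two points are `(x, y')` and `(x', y)`, parallel exactly when `x * y
  -- = x' * y'`.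
  refine card_le_card_of_injOn
    (fun x => ((x.1.1 - a, x.2.2 - a'), (x.1.2 - a, x.2.1 - a'))) ?_ ?_
  · intro x hx
    simp only [coe_filter, mem_product, Set.mem_ofPred_eq] at hx
    obtain ⟨⟨⟨h1, h2⟩, h3, h4⟩, h5⟩ := hx
    simp only [coe_filter, mem_product, Set.mem_ofPred_eq, pointsOnLine, mem_filter]
    exact ⟨⟨⟨hmem h1, hmem h4⟩, hmem h2, hmem h3⟩, ⟨hmem h2, hmem h3⟩, by linear_combination h5⟩
  · rintro ⟨⟨x, x'⟩, y, y'⟩ - ⟨⟨z, z'⟩, w, w'⟩ - h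
    simp only [Prod.mk.injEq, sub_left_inj] at h ⊢
    tauto

lemma sum_mulEnergy_translate_le :
    ∃ C : ℝ, 0 < C ∧ ∀ A : Finset ℝ, 2 ≤ #A →
      ∑ a ∈ A, ∑ a' ∈ A, ((mulEnergy ({a} + A) ({a'} + A) : ℕ) : ℝ) ≤
        C * ((#A : ℝ) ^ 4 * Real.log #A) := by
  refine ⟨289 * 16 * 4, by norm_num, fun A hA => ?_⟩
  have hA' : (2 : ℝ) ≤ #A := by exact_mod_cast hA
  -- Adjoining the negatives puts `(-a, -a')` in the grid.
  set B := A ∪ A.image Neg.neg with hBdef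
  have hAB : A ⊆ B := subset_union_left
  have hneg {a : ℝ} (ha : a ∈ A) : -a ∈ B := mem_union_right _ (mem_image_of_mem _ ha)
  have hBne : B.Nonempty := (card_pos.1 (by omega : 0 < #A)).mono hAB
  have hcard : (#B : ℝ) ≤ 2 * #A := by
    have h : #B ≤ #A + #(A.image Neg.neg) := card_union_le _ _
    have h' : #(A.image Neg.neg) ≤ #A := card_image_le
    have : #B ≤ 2 * #A := by omega
    exact_mod_cast this
  have hBpos : (0 : ℝ) < #B := by exact_mod_cast hBne.card_pos
  have hlog : 1 + Real.log #B ≤ 4 * Real.log #A := by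
    have h1 : Real.log #B ≤ Real.log 2 + Real.log #A := by
      rw [← Real.log_mul (by norm_num) (by positivity)]
      exact Real.log_le_log hBpos hcard
    have h2 : Real.log 2 ≤ Real.log #A := Real.log_le_log (by norm_num) hA'
    have h3 := Real.log_two_gt_d9
    linarith
  have hlog0 : 0 ≤ 1 + Real.log #B := by
    have : 0 ≤ Real.log #B := Real.log_nonneg (by exact_mod_cast hBne.card_pos)
    linarith
  set F : ℝ × ℝ → ℝ := fun p => ∑ q ∈ B ×ˢ B, (#(pointsOnLine (B ×ˢ B) p q) : ℝ) with hF
  calc ∑ a ∈ A, ∑ a' ∈ A, ((mulEnergy ({a} + A) ({a'} + A) : ℕ) : ℝ)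
      ≤ ∑ a ∈ A, ∑ a' ∈ A, F (-a, -a') := by
        refine sum_le_sum fun a _ => sum_le_sum fun a' _ => ?_
        simp only [hF]
        exact_mod_cast mulEnergy_translate_le hAB a a'
    _ = ∑ p ∈ (A ×ˢ A).image Neg.neg, F p := by
        rw [sum_image neg_injective.injOn, sum_product]
        rfl
    _ ≤ ∑ p ∈ B ×ˢ B, F p := by
        refine sum_le_sum_of_subset_of_nonneg ?_ fun _ _ _ =>
          sum_nonneg fun _ _ => Nat.cast_nonneg _
        intro p hp
        obtain ⟨x, hx, rfl⟩ := mem_image.1 hp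
        rw [mem_product] at hx
        exact mem_product.2 ⟨hneg hx.1, hneg hx.2⟩
    _ ≤ 289 * (#B : ℝ) ^ 4 * (1 + Real.log #B) := sum_card_pointsOnLine_le hBne
    _ ≤ 289 * (2 * #A : ℝ) ^ 4 * (4 * Real.log #A) := by gcongr
    _ = _ := by ring

lemma exists_card_mul_translate_ge :
    ∃ c : ℝ, 0 < c ∧ ∀ A : Finset ℝ, 2 ≤ #A → ∃ a ∈ A, ∃ a' ∈ A,
      c * ((#A : ℝ) ^ 2 / Real.log #A) ≤ (#((A + {a}) * (A + {a'}) : Finset ℝ) : ℝ) := by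
  obtain ⟨C, hC, h⟩ := sum_mulEnergy_translate_le
  refine ⟨C⁻¹, by positivity, fun A hA => ?_⟩
  have hA' : (2 : ℝ) ≤ #A := by exact_mod_cast hA
  have hlog : 0 < Real.log #A := Real.log_pos (by linarith)
  have hne : A.Nonempty := card_pos.1 (by omega)
  obtain ⟨x, hx, hx'⟩ : ∃ x ∈ A ×ˢ A, ((mulEnergy ({x.1} + A) ({x.2} + A) : ℕ) : ℝ) ≤
      C * ((#A : ℝ) ^ 2 * Real.log #A) := by
    refine exists_le_of_sum_le (hne.product hne) ?_
    rw [sum_product, sum_const, card_product, nsmul_eq_mul]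
    refine (h A hA).trans_eq ?_
    push_cast
    ring
  rw [mem_product] at hx
  refine ⟨x.1, hx.1, x.2, hx.2, ?_⟩
  have hE := le_card_mul_mul_mulEnergy ({x.1} + A) ({x.2} + A)
  rw [card_singleton_add, card_singleton_add] at hE
  rw [add_comm A, add_comm A]
  have hE' : (#A : ℝ) ^ 2 * #A ^ 2 ≤ #(({x.1} + A) * ({x.2} + A)) *
      ((mulEnergy ({x.1} + A) ({x.2} + A) : ℕ) : ℝ) := by exact_mod_cast hE
  have hE'' := hE'.trans (mul_le_mul_of_nonneg_left hx' (Nat.cast_nonneg _))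
  have hsq : (0 : ℝ) < (#A : ℝ) ^ 2 := by positivity
  have hfin : (#A : ℝ) ^ 2 ≤ #(({x.1} + A) * ({x.2} + A)) * (C * Real.log #A) := by
    refine le_of_mul_le_mul_right ?_ hsq
    linarith
  rw [inv_mul_eq_div, div_div, div_le_iff₀ (by positivity)]
  linarith

end CollinearTriples

theorem mainTheorem4 :
    (∃ c : ℝ, 0 < c ∧ ∀ A : Finset ℝ, 2 ≤ A.card →
      ∃ a ∈ A, ∃ a' ∈ A,
        c * ((A.card : ℝ) ^ 2 / Real.log (A.card : ℝ)) ≤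
          (((A + {a}) * (A + {a'}) : Finset ℝ).card : ℝ)) ∧
    (∃ c : ℝ, 0 < c ∧ ∀ A : Finset ℝ, 2 ≤ A.card →
      c * ((A.card : ℝ) ^ 2 / Real.log (A.card : ℝ)) ≤
        (((A + A) * (A + A) : Finset ℝ).card : ℝ)) ∧
    (∃ C : ℝ, 0 < C ∧ ∀ A : Finset ℝ, 2 ≤ A.card →
      ∑ a ∈ A, ∑ a' ∈ A, ((Finset.mulEnergy ({a} + A) ({a'} + A) : ℕ) : ℝ) ≤
        C * ((A.card : ℝ) ^ 4 * Real.log (A.card : ℝ))) := by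
  refine ⟨exists_card_mul_translate_ge, ?_, sum_mulEnergy_translate_le⟩
  obtain ⟨c, hc, h⟩ := exists_card_mul_translate_ge
  refine ⟨c, hc, fun A hA => ?_⟩
  obtain ⟨a, ha, a', ha', h'⟩ := h A hA
  refine h'.trans ?_
  exact_mod_cast Finset.card_le_card (Finset.mul_subset_mul
    (Finset.add_subset_add_left (Finset.singleton_subset_iff.2 ha))
    (Finset.add_subset_add_left (Finset.singleton_subset_iff.2 ha')))
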